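/- Let $d\ge 2$, let $H\le \mathrm{GL}(d,\mathbb R)$ be a closed subgroup with left Haar measure $\mathrm dh$, acting on $\mathbb R^d$ by the dual action $(h,\xi)\mapsto h^T\xi$, and let $\mathcal O=H^T\xi_0=\{h^T\xi_0: h\in H\}$ be an open orbit whose stabilizers $\{h\in H: h^T\eta=\eta\}$, $\eta\in\mathcal O$, are compact. Notation. The Fourier transform is $\widehat f(\xi)=\int f(x)e^{-2\pi i\langle x,\xi\rangle}\,\mathrm dx$. For relatively open $W\subset S^{d-1}$ and $R>0$ put $C(W)=\{r\xi': \xi'\in W,\ r>0\}$ and $C(W,R)=C(W)\setminus\overline{B_R}(0)$. For $V\subset\mathbb R^d$ put $K_o(W,V,R)=\{h\in H: h^{-T}V\cap C(W,R)\ne\emptyset\}$. A point $(x,\xi)\in\mathbb R^d\times S^{d-1}$ is a regular directed point of $u\in\mathcal S'(\mathbb R^d)$ if there are $\varphi\in C_c^\infty(\mathbb R^d)$, identically $1$ near $x$, and a relatively open $W\subset S^{d-1}$ with $\xi\in W$, such that for every integer $N\ge1$ there is $C_N>0$ with $|\widehat{\varphi u}(\eta)|\le C_N(1+|\eta|)^{-N}$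 for all $\eta\in C(W)$. For $\psi\in\mathcal S(\mathbb R^d)$ the wavelet transform is $(W_\psi u)(x,h)=u\big(\overline{\pi(x,h)\psi}\big)$, where $[\pi(x,h)\psi](y)=|\det h|^{-1/2}\psi(h^{-1}(y-x))$. A function $\psi\in\mathcal S(\mathbb R^d)$ is admissible if $\widehat\psi$ has compact support contained in $\mathcal O$ and $\int_H|\widehat\psi(h^T\eta)|^2\,\mathrm dh=1$ for all $\eta\in\mathcal O$. The operator norm of $h$ with respect to the euclidean norm is denoted by $\|h\|$. Suppose that there are $x\in\mathbb R^d$, $\xi\in\mathcal O\cap S^{d-1}$ and a nonempty open set $V$ with compact closure $\overline V\subset\mathcal O$ such that the following holds: for every $u\in\mathcal S'(\mathbb R^d)$ having $(x,\xi)$ as a regular directed point and every admissible $\psi\in\mathcal S(\mathbb R^d)$ with $\operatorname{supp}\widehat\psi\subset V$ there are a relatively open $W\subset S^{d-1}$ with $\xi\in W$ and an $R>0$ such that for every integer $N\ge1$ there is $C_N>0$ with $$|(W_\psi u)(x,h)|\le C_N\,\|h\|^N\qquad\text{for all }h\in K_o(W,V,R).$$ Then $H\cap\big[(0,\infty)\cdot\mathrm{id}\big]=\{\mathrm{id}\}$.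 -/

import Mathlib

open MeasureTheory Topology
open scoped SchwartzMap FourierTransform ContDiff Matrix

noncomputable section

namespace WaveletWF

/-- `ℝ^d` with the euclidean norm. -/
abbrev E (d : ℕ) : Type := EuclideanSpace ℝ (Fin d)

/-- The unit sphere `S^{d-1}` of `ℝ^d`. -/
abbrev Sph (d : ℕ) : Type := Metric.sphere (0 : E d) 1

/-- The linear automorphism `y ↦ h y` of `ℝ^d` given by an invertible matrix `h`. -/
def matAct {d : ℕ} (h : GL (Fin d) ℝ) : E d ≃L[ℝ] E d :=
  ContinuousLinearEquiv.unitsEquiv ℝ (E d)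
    (Units.map (Matrix.toEuclideanCLM (n := Fin d) (𝕜 := ℝ) : _ →* (E d →L[ℝ] E d)) h)

theorem matAct_apply {d : ℕ} (h : GL (Fin d) ℝ) (y : E d) :
    matAct h y = WithLp.toLp 2 ((h : Matrix (Fin d) (Fin d) ℝ) *ᵥ y.ofLp) := rfl

/-- The operator norm `‖h‖` with respect to the euclidean norm. -/
def opNorm {d : ℕ} (h : GL (Fin d) ℝ) : ℝ := ‖(matAct h : E d →L[ℝ] E d)‖

/-- The dual action `(h, ξ) ↦ hᵀ ξ`. -/
def dualAct {d : ℕ} (h : GL (Fin d) ℝ) (ξ : E d) : E d :=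
  Matrix.toEuclideanCLM (n := Fin d) (𝕜 := ℝ) (h : Matrix (Fin d) (Fin d) ℝ)ᵀ ξ

/-- The dual orbit `Hᵀ ξ₀ = {hᵀ ξ₀ | h ∈ H}`. -/
def dualOrbit {d : ℕ} (H : Subgroup (GL (Fin d) ℝ)) (ξ₀ : E d) : Set (E d) :=
  {ξ | ∃ h ∈ H, dualAct h ξ₀ = ξ}

/-- The stabilizer `{h ∈ H | hᵀ ξ = ξ}` of `ξ` under the dual action, as a subset of `H`. -/
def dualStabilizer {d : ℕ} (H : Subgroup (GL (Fin d) ℝ)) (ξ : E d) : Set H :=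
  {h | dualAct (h : GL (Fin d) ℝ) ξ = ξ}

/-- `V ⋐ O`: both sets are open, and the closure of `V` is a compact subset of `O`. -/
def CompactlyInside {d : ℕ} (V O : Set (E d)) : Prop :=
  IsOpen V ∧ IsOpen O ∧ IsCompact (closure V) ∧ closure V ⊆ O

/-- The cone `C(W) = {r w | w ∈ W, r > 0}` over a set `W` of directions. -/
def cone {d : ℕ} (W : Set (Sph d)) : Set (E d) :=
  {η | ∃ w ∈ W, ∃ r : ℝ, 0 < r ∧ η = r • (w : E d)}

/-- The truncated cone `C(W, R)`, i.e. `C(W)` without the closed ball of radius `R` around `0`. -/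
def truncCone {d : ℕ} (W : Set (Sph d)) (R : ℝ) : Set (E d) :=
  cone W \ Metric.closedBall 0 R

/-- `K_o(W, V, R) = {h ∈ H | h⁻ᵀ V ∩ C(W, R) ≠ ∅}`. -/
def outerSet {d : ℕ} (H : Subgroup (GL (Fin d) ℝ)) (W : Set (Sph d)) (V : Set (E d)) (R : ℝ) :
    Set (GL (Fin d) ℝ) :=
  {h | h ∈ H ∧ ((dualAct h⁻¹ '' V) ∩ truncCone W R).Nonempty}

/-- The quasi-regular representation on Schwartz functions,
`[π(x, h) f](y) = |det h|^{-1/2} f(h⁻¹ (y - x))`. -/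
def quasiReg {d : ℕ} (x : E d) (h : GL (Fin d) ℝ) (f : 𝓢(E d, ℂ)) : 𝓢(E d, ℂ) :=
  ((|(h : Matrix (Fin d) (Fin d) ℝ).det| ^ (-(1 / 2) : ℝ) : ℝ) : ℂ) •
    SchwartzMap.compSubConstCLM ℂ x
      (SchwartzMap.compCLMOfContinuousLinearEquiv ℂ (matAct h⁻¹) f)

theorem quasiReg_apply {d : ℕ} (x : E d) (h : GL (Fin d) ℝ) (f : 𝓢(E d, ℂ)) (y : E d) :
    quasiReg x h f y =
      ((|(h : Matrix (Fin d) (Fin d) ℝ).det| ^ (-(1 / 2) : ℝ) : ℝ) : ℂ) *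
        f (matAct h⁻¹ (y - x)) := rfl

/-- The complex conjugate of a Schwartz function. -/
def conjS {d : ℕ} (f : 𝓢(E d, ℂ)) : 𝓢(E d, ℂ) :=
  SchwartzMap.postcompCLM (𝕜 := ℝ) (Complex.conjCLE : ℂ →L[ℝ] ℂ) f

theorem conjS_apply {d : ℕ} (f : 𝓢(E d, ℂ)) (y : E d) :
    conjS f y = (starRingEnd ℂ) (f y) := rfl

/-- The wavelet transform `(W_ψ u)(x, h) = ⟨u | π(x, h) ψ⟩`, where `⟨u | f⟩ = u (conj f)` is the
extension of the `L²` scalar product. -/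
def waveletTransform {d : ℕ} (ψ : 𝓢(E d, ℂ)) (u : 𝓢'(E d, ℂ)) (x : E d) (h : GL (Fin d) ℝ) : ℂ :=
  u (conjS (quasiReg x h ψ))

/-- The tempered distribution `T` is given by integration against the function `g`. -/
def IsGivenBy {d : ℕ} (T : 𝓢'(E d, ℂ)) (g : E d → ℂ) : Prop :=
  ∀ f : 𝓢(E d, ℂ), Integrable (fun η => f η * g η) ∧ T f = ∫ η, f η * g η

/-- `(x, ξ)` is a regular directed point of `u`: for some cutoff function `φ` at `x` and some
neighborhood `W` of `ξ` in the sphere, the Fourier transform of `φ u` decays rapidly on `C(W)`.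
Since `φ u` has compact support, its Fourier transform is (given by) a unique continuous
function, which is called `g` here. -/
def IsRegularDirectedPoint {d : ℕ} (u : 𝓢'(E d, ℂ)) (x : E d) (ξ : Sph d) : Prop :=
  ∃ φ : E d → ℂ, ContDiff ℝ ∞ φ ∧ HasCompactSupport φ ∧ (∀ᶠ y in 𝓝 x, φ y = 1) ∧
    ∃ g : E d → ℂ, Continuous g ∧ IsGivenBy (𝓕 (TemperedDistribution.smulLeftCLM ℂ φ u)) g ∧
      ∃ W : Set (Sph d), IsOpen W ∧ ξ ∈ W ∧
        ∀ N : ℕ, 1 ≤ N → ∃ C : ℝ, 0 < C ∧ ∀ η ∈ cone W, ‖g η‖ ≤ C * ((1 + ‖η‖) ^ N)⁻¹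

/-- `ψ` is admissible: its Fourier transform is compactly supported inside `O`, and
`∫_H |ψ̂(hᵀ η)|² dh = 1` for all `η ∈ O`. -/
def IsAdmissible {d : ℕ} (H : Subgroup (GL (Fin d) ℝ)) [MeasurableSpace H] (μ : Measure H)
    (O : Set (E d)) (ψ : 𝓢(E d, ℂ)) : Prop :=
  HasCompactSupport (𝓕 ψ : 𝓢(E d, ℂ)) ∧ tsupport (𝓕 ψ : 𝓢(E d, ℂ)) ⊆ O ∧
    ∀ η ∈ O, Integrable (fun h : H => ‖(𝓕 ψ : 𝓢(E d, ℂ)) (dualAct (h : GL (Fin d) ℝ) η)‖ ^ 2) μ ∧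
      ∫ h : H, ‖(𝓕 ψ : 𝓢(E d, ℂ)) (dualAct (h : GL (Fin d) ℝ) η)‖ ^ 2 ∂μ = 1

end WaveletWF

end

noncomputable section

namespace WaveletWF

variable {d : ℕ}

/-! Suppose `g = r • 1` lies in `H` with `0 < r < 1`. Choose `h ∈ H` with `hᵀ ξ ∈ V` and perturb `ξ`
to `η`, off the ray of `ξ`, so that still `hᵀ η ∈ V`. Let `u` have Fourier transform `∑ 2⁻ᵐ δ_{r⁻ᵐ
η}`. Its frequencies lie in a hyperplane missing `ξ`, so `(x, ξ)` is a regular directed point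
(`isRegularDirectedPoint_fourierInv_measure`). The elements `gⁿ h` nevertheless lie in `K_o(W, V,
R)` for large `n`, however small `W` is, because `hᵀ ξ ∈ V` (`mem_outerSet_scalar_pow_mul`).

If `ψ̂` is concentrated near `hᵀ η`, the transform at `gⁿ h` sees only the frequency `r⁻ⁿ η`, and
its modulus is exactly `A qⁿ` with `A, q > 0` (`norm_waveletTransform_geometricDiracSum`). The
assumed decay bounds this by a multiple of `r^{nN}` for every `N`, which is absurd. Such an
admissible `ψ` comes from `exists_isAdmissible`. Expanding homotheties are excluded by passing to
`g⁻¹`. -/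

instance locallyCompactSpace_GL : LocallyCompactSpace (GL (Fin d) ℝ) := by
  have : LocallyCompactSpace (Matrix (Fin d) (Fin d) ℝ) :=
    inferInstanceAs (LocallyCompactSpace (Fin d → Fin d → ℝ))
  infer_instance

instance secondCountableTopology_GL : SecondCountableTopology (GL (Fin d) ℝ) := by
  have : SecondCountableTopology (Matrix (Fin d) (Fin d) ℝ) :=
    inferInstanceAs (SecondCountableTopology (Fin d → Fin d → ℝ))
  have : SecondCountableTopology (Matrix (Fin d) (Fin d) ℝ)ᵐᵒᵖ :=
    MulOpposite.opHomeomorph.symm.isInducing.secondCountableTopology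
  exact Units.isInducing_embedProduct.secondCountableTopology

/-! ### The dual action and its orbit maps -/

theorem dualAct_eq_toLp (h : GL (Fin d) ℝ) (ξ : E d) :
    dualAct h ξ = WithLp.toLp 2 ((h : Matrix (Fin d) (Fin d) ℝ)ᵀ *ᵥ ξ.ofLp) := rfl

theorem dualAct_one (ξ : E d) : dualAct 1 ξ = ξ := by
  simp [dualAct_eq_toLp]

theorem dualAct_mul (h k : GL (Fin d) ℝ) (ξ : E d) :
    dualAct (h * k) ξ = dualAct k (dualAct h ξ) := by
  simp [dualAct_eq_toLp, Matrix.transpose_mul, Matrix.mulVec_mulVec]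

theorem dualAct_inv_dualAct (h : GL (Fin d) ℝ) (ξ : E d) : dualAct h⁻¹ (dualAct h ξ) = ξ := by
  rw [← dualAct_mul, mul_inv_cancel, dualAct_one]

theorem dualAct_smul (h : GL (Fin d) ℝ) (c : ℝ) (ξ : E d) :
    dualAct h (c • ξ) = c • dualAct h ξ :=
  map_smul (Matrix.toEuclideanCLM (n := Fin d) (𝕜 := ℝ) (h : Matrix (Fin d) (Fin d) ℝ)ᵀ) c ξ

theorem continuous_dualAct {X : Type*} [TopologicalSpace X] {f : X → GL (Fin d) ℝ} {g : X → E d}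
    (hf : Continuous f) (hg : Continuous g) : Continuous fun x => dualAct (f x) (g x) := by
  simp only [dualAct_eq_toLp]
  exact (PiLp.continuous_toLp 2 _).comp
    (((Units.continuous_val.comp hf).matrix_transpose).matrix_mulVec
      ((PiLp.continuous_ofLp 2 _).comp hg))

/-- The orbit maps of a continuous right action of a `σ`-compact group are open, provided that the
orbit is an open subset of a locally compact Hausdorff space. -/
theorem isOpenMap_orbitMap {G X : Type*} [Group G] [TopologicalSpace G] [IsTopologicalGroup G]
    [SigmaCompactSpace G] [TopologicalSpace X] [T2Space X] [LocallyCompactSpace X]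
    (act : G → X → X) (act_one : ∀ x, act 1 x = x)
    (act_mul : ∀ g h x, act (g * h) x = act h (act g x))
    (hact : Continuous fun p : G × X => act p.1 p.2) (x₀ : X)
    (hopen : IsOpen (Set.range fun g => act g x₀)) : IsOpenMap fun g => act g x₀ := by
  have : LocallyCompactSpace (Set.range fun g => act g x₀) := hopen.locallyCompactSpace
  -- The inverse turns the right action into a left one; composing with inversion at the end undoes
  -- it.
  let A : MulAction G (Set.range fun g => act g x₀) :=
    { smul := fun g y => ⟨act g⁻¹ y, by
        obtain ⟨_, k, rfl⟩ := y
        exact ⟨k * g⁻¹, act_mul _ _ _⟩⟩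
      one_smul := fun y => Subtype.ext (by
        change act 1⁻¹ (y : X) = y
        rw [inv_one, act_one])
      mul_smul := fun g h y => Subtype.ext (by
        change act (g * h)⁻¹ (y : X) = act g⁻¹ (act h⁻¹ y)
        rw [← act_mul, mul_inv_rev]) }
  have hsmul : ∀ (g : G) (y : Set.range fun g => act g x₀), ((g • y : _) : X) = act g⁻¹ y :=
    fun _ _ => rfl
  have : ContinuousSMul G (Set.range fun g => act g x₀) := ⟨by
    refine continuous_induced_rng.2 ?_
    exact hact.comp (continuous_fst.inv.prodMk (continuous_subtype_val.comp continuous_snd))⟩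
  have : MulAction.IsPretransitive G (Set.range fun g => act g x₀) := ⟨by
    rintro ⟨_, k, rfl⟩ ⟨_, l, rfl⟩
    refine ⟨l⁻¹ * k, Subtype.ext ?_⟩
    rw [hsmul, ← act_mul]
    simp⟩
  have key := isOpenMap_smul_of_sigmaCompact (G := G)
    (⟨x₀, 1, act_one x₀⟩ : Set.range fun g => act g x₀)
  convert! (hopen.isOpenMap_subtype_val.comp key).comp (Homeomorph.inv G).isOpenMap using 2 with g
  simp [hsmul]

theorem dualOrbit_eq_range (H : Subgroup (GL (Fin d) ℝ)) (ξ₀ : E d) :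
    dualOrbit H ξ₀ = Set.range fun h : H => dualAct (h : GL (Fin d) ℝ) ξ₀ := by
  ext η
  simp [dualOrbit]

/-- The orbit map onto an open dual orbit of a closed matrix group is open. -/
theorem isOpenMap_dualAct (H : Subgroup (GL (Fin d) ℝ)) (hH : IsClosed (H : Set (GL (Fin d) ℝ)))
    (ξ₀ : E d) (hopen : IsOpen (dualOrbit H ξ₀)) :
    IsOpenMap fun h : H => dualAct (h : GL (Fin d) ℝ) ξ₀ := by
  have : LocallyCompactSpace H := hH.isClosedEmbedding_subtypeVal.locallyCompactSpace
  have : SecondCountableTopology H :=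
    TopologicalSpace.Subtype.secondCountableTopology (H : Set (GL (Fin d) ℝ))
  have : SigmaCompactSpace H := inferInstance
  refine isOpenMap_orbitMap (fun (h : H) (η : E d) => dualAct (h : GL (Fin d) ℝ) η)
    ?_ ?_ ?_ ξ₀ ?_
  · intro η
    rw [Subgroup.coe_one, dualAct_one]
  · intro g h η
    rw [Subgroup.coe_mul, dualAct_mul]
  · have h1 : Continuous fun p : H × E d => (p.1 : GL (Fin d) ℝ) :=
      Continuous.subtype_val continuous_fst
    exact continuous_dualAct h1 continuous_snd
  · rw [← dualOrbit_eq_range]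
    exact hopen

/-- The preimage of the image of a compact set under an orbit map with compact stabilizer is
compact. -/
theorem isCompact_saturation (H : Subgroup (GL (Fin d) ℝ)) (ξ₀ : E d)
    (hstab : IsCompact (dualStabilizer H ξ₀)) {U : Set H} (hU : IsCompact U) :
    IsCompact {h : H | ∃ k ∈ U,
      dualAct (h : GL (Fin d) ℝ) ξ₀ = dualAct (k : GL (Fin d) ℝ) ξ₀} := by
  -- The saturation is the product of the stabilizer with `U`.
  convert hstab.mul hU using 1
  ext h
  rw [Set.mem_mul]
  constructor
  · rintro ⟨k, hk, he⟩
    refine ⟨h * k⁻¹, ?_, k, hk, by simp⟩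
    change dualAct ((h * k⁻¹ : H) : GL (Fin d) ℝ) ξ₀ = ξ₀
    rw [Subgroup.coe_mul, dualAct_mul, he, Subgroup.coe_inv, dualAct_inv_dualAct]
  · rintro ⟨s, hs, k, hk, rfl⟩
    refine ⟨k, hk, ?_⟩
    rw [Subgroup.coe_mul, dualAct_mul]
    congr 1

/-! ### Admissible functions with small Fourier support -/

/-- Near every point of an open dual orbit with compact stabilizers there are admissible functions
whose Fourier transform does not vanish at that point. -/
theorem exists_isAdmissible (H : Subgroup (GL (Fin d) ℝ)) (hH : IsClosed (H : Set (GL (Fin d) ℝ)))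
    [MeasurableSpace H] [BorelSpace H] (μ : Measure H) [μ.IsHaarMeasure] (ξ₀ : E d)
    (hopen : IsOpen (dualOrbit H ξ₀)) (hstab : IsCompact (dualStabilizer H ξ₀))
    {p : E d} (hp : p ∈ dualOrbit H ξ₀) {B : Set (E d)} (hB : B ∈ 𝓝 p) :
    ∃ ψ : 𝓢(E d, ℂ), IsAdmissible H μ (dualOrbit H ξ₀) ψ ∧
      tsupport (𝓕 ψ : 𝓢(E d, ℂ)) ⊆ B ∧ (𝓕 ψ : 𝓢(E d, ℂ)) p ≠ 0 := by
  have : LocallyCompactSpace H := hH.isClosedEmbedding_subtypeVal.locallyCompactSpace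
  obtain ⟨h₁, hh₁, rfl⟩ := hp
  obtain ⟨U, hUc, hU⟩ := exists_compact_mem_nhds (⟨h₁, hh₁⟩ : H)
  have hcont : Continuous fun h : H => dualAct (h : GL (Fin d) ℝ) ξ₀ :=
    continuous_dualAct (Continuous.subtype_val continuous_id) continuous_const
  have hN := (isOpenMap_dualAct H hH ξ₀ hopen).image_mem_nhds hU
  obtain ⟨ε, hε, hball⟩ := Metric.nhds_basis_closedBall.mem_iff.1 (Filter.inter_mem hN hB)
  let b : ContDiffBump (dualAct h₁ ξ₀) := ⟨ε / 2, ε, half_pos hε, half_lt_self hε⟩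
  let f : E d → ℂ := fun y => (b y : ℂ)
  have hfs : ContDiff ℝ ∞ f := Complex.ofRealCLM.contDiff.comp b.contDiff
  have hts : tsupport f ⊆ Metric.closedBall (dualAct h₁ ξ₀) ε := by
    rw [← b.tsupport_eq]
    exact closure_mono fun y hy => by simpa [f] using hy
  have hfc : HasCompactSupport f :=
    HasCompactSupport.of_support_subset_isCompact (isCompact_closedBall _ _)
      ((subset_tsupport f).trans hts)
  have hfp : f (dualAct h₁ ξ₀) = 1 := by
    have : b (dualAct h₁ ξ₀) = 1 := b.one_of_mem_closedBall (Metric.mem_closedBall_self b.rIn_pos.le)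
    simp [f, this]
  let G : H → ℝ := fun h => ‖f (dualAct (h : GL (Fin d) ℝ) ξ₀)‖ ^ 2
  have hGcont : Continuous G := ((hfs.continuous.comp hcont).norm.pow 2)
  -- The bump lives on the image of `U`, so its pullback to `H` lives on the saturation of `U`;
  -- compactness of the stabilizer enters here.
  have hGc : HasCompactSupport G := by
    refine HasCompactSupport.intro (isCompact_saturation H ξ₀ hstab hUc) fun h hh => ?_
    have : f (dualAct (h : GL (Fin d) ℝ) ξ₀) = 0 := by
      by_contra hne
      obtain ⟨k, hk, he⟩ := (hball (hts (subset_tsupport f hne))).1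
      exact hh ⟨k, hk, he.symm⟩
    simp [G, this]
  have hGint : Integrable G μ := hGcont.integrable_of_hasCompactSupport hGc
  have hpos : 0 < ∫ h, G h ∂μ :=
    hGcont.integral_pos_of_hasCompactSupport_nonneg_nonzero hGc (fun _ => sq_nonneg _)
      (x := ⟨h₁, hh₁⟩) (by simp [G, hfp])
  set c := ∫ h, G h ∂μ with hc
  let F : 𝓢(E d, ℂ) := (((Real.sqrt c)⁻¹ : ℝ) : ℂ) • hfc.toSchwartzMap hfs
  have hsc : (((Real.sqrt c)⁻¹ : ℝ) : ℂ) ≠ 0 := by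
    simpa using (Real.sqrt_pos.2 hpos).ne'
  have hF : ∀ y, F y = (((Real.sqrt c)⁻¹ : ℝ) : ℂ) * f y := fun y => rfl
  have hFn : ∀ y, ‖F y‖ ^ 2 = c⁻¹ * ‖f y‖ ^ 2 := fun y => by
    rw [hF, norm_mul, mul_pow, Complex.norm_real, Real.norm_eq_abs, sq_abs, inv_pow,
      Real.sq_sqrt hpos.le]
  have hFsupp : tsupport F ⊆ tsupport f :=
    closure_mono fun y hy hy0 => hy (by simp [hF, hy0])
  refine ⟨𝓕⁻ F, ?_⟩
  have hinv : 𝓕 (𝓕⁻ F) = F := FourierTransform.fourier_fourierInv_eq F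
  rw [IsAdmissible, hinv]
  refine ⟨⟨?_, ?_, ?_⟩, ?_, ?_⟩
  · exact hfc.of_isClosed_subset (isClosed_tsupport _) hFsupp
  · refine (hFsupp.trans hts).trans fun y hy => ?_
    obtain ⟨k, hk, rfl⟩ := (hball hy).1
    exact ⟨k, k.2, rfl⟩
  · rintro _ ⟨k, hk, rfl⟩
    -- Moving the base point along the orbit is a left translation in `H`, so by left invariance one
    -- normalization serves all points.
    have heq : (fun h : H => ‖F (dualAct (h : GL (Fin d) ℝ) (dualAct k ξ₀))‖ ^ 2) =
        fun h => c⁻¹ * G ((⟨k, hk⟩ : H) * h) := by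
      funext h
      rw [hFn, ← dualAct_mul]
      rfl
    rw [heq]
    refine ⟨(hGint.comp_mul_left _).const_mul _, ?_⟩
    rw [integral_const_mul, integral_mul_left_eq_self, ← hc, inv_mul_cancel₀ hpos.ne']
  · exact (hFsupp.trans hts).trans fun y hy => (hball hy).2
  · rw [hF, hfp, mul_one]
    exact hsc

/-! ### Wavelet transforms on the Fourier side -/

theorem det_matAct (h : GL (Fin d) ℝ) :
    LinearMap.det ((matAct h : E d →L[ℝ] E d) : E d →ₗ[ℝ] E d) =
      (h : Matrix (Fin d) (Fin d) ℝ).det :=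
  LinearMap.det_toLpLin 2 (h : Matrix (Fin d) (Fin d) ℝ)

theorem matAct_matAct_inv (h : GL (Fin d) ℝ) (y : E d) : matAct h (matAct h⁻¹ y) = y := by
  simp [matAct_apply, Matrix.mulVec_mulVec]

theorem inner_matAct (h : GL (Fin d) ℝ) (y a : E d) :
    inner ℝ (matAct h y) a = inner ℝ y (dualAct h a) := by
  simp only [matAct_apply, dualAct_eq_toLp, EuclideanSpace.inner_eq_star_dotProduct]
  simp [Matrix.dotProduct_mulVec, Matrix.vecMul_transpose, dotProduct_comm]

theorem abs_det_pos (h : GL (Fin d) ℝ) : 0 < |(h : Matrix (Fin d) (Fin d) ℝ).det| :=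
  abs_pos.2 ((Matrix.isUnit_iff_isUnit_det _).1 h.isUnit).ne_zero

/-- Change of variables `v = h w + x`. -/
theorem integral_comp_matAct_inv_sub (h : GL (Fin d) ℝ) (x : E d) (g : E d → ℂ) :
    ∫ v, g (matAct h⁻¹ (v - x)) = |(h : Matrix (Fin d) (Fin d) ℝ).det| • ∫ w, g w := by
  rw [integral_sub_right_eq_self fun v => g (matAct h⁻¹ v)]
  have hdet : LinearMap.det ((matAct h⁻¹ : E d →L[ℝ] E d) : E d →ₗ[ℝ] E d) =
      (h : Matrix (Fin d) (Fin d) ℝ).det⁻¹ := by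
    rw [det_matAct, Matrix.coe_units_inv, Matrix.det_nonsing_inv, Ring.inverse_eq_inv']
  have hne := abs_pos.1 (abs_det_pos h)
  have hmap := Measure.map_linearMap_addHaar_eq_smul_addHaar (volume : Measure (E d))
    (f := ((matAct h⁻¹ : E d →L[ℝ] E d) : E d →ₗ[ℝ] E d)) (by rw [hdet]; exact inv_ne_zero hne)
  rw [hdet, inv_inv] at hmap
  have hemb : MeasurableEmbedding (matAct h⁻¹ : E d → E d) :=
    (matAct h⁻¹).toHomeomorph.measurableEmbedding
  rw [← hemb.integral_map g]
  change ∫ y, g y ∂(Measure.map (matAct h⁻¹ : E d → E d) volume) = _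
  erw [hmap]
  rw [integral_smul_measure, ENNReal.toReal_ofReal (abs_nonneg _)]

/-- Translation contributes only a phase; the Jacobian `|det h|` meets the normalization `|det
h|^{-1/2}`. -/
theorem norm_fourier_quasiReg (x : E d) (h : GL (Fin d) ℝ) (ψ : 𝓢(E d, ℂ)) (a : E d) :
    ‖(𝓕 (quasiReg x h ψ) : 𝓢(E d, ℂ)) a‖ =
      |(h : Matrix (Fin d) (Fin d) ℝ).det| ^ (1 / 2 : ℝ) *
        ‖(𝓕 ψ : 𝓢(E d, ℂ)) (dualAct h a)‖ := by
  set D := |(h : Matrix (Fin d) (Fin d) ℝ).det| with hD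
  have hDpos : 0 < D := abs_det_pos h
  set c : ℂ := ((D ^ (-(1 / 2) : ℝ) : ℝ) : ℂ) with hc
  have key : (𝓕 (quasiReg x h ψ) : 𝓢(E d, ℂ)) a =
      D • (((𝐞 (-inner ℝ x a) : Circle) : ℂ) * c * (𝓕 ψ : 𝓢(E d, ℂ)) (dualAct h a)) := by
    simp only [SchwartzMap.fourier_coe, Real.fourier_eq, quasiReg_apply]
    have := integral_comp_matAct_inv_sub h x
      fun w => 𝐞 (-inner ℝ (matAct h w + x) a) • (c * ψ w)
    simp only [matAct_matAct_inv, sub_add_cancel] at this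
    rw [this, ← integral_const_mul]
    congr 1
    refine integral_congr_ae (.of_forall fun w => ?_)
    simp only [inner_add_left, inner_matAct, neg_add, AddChar.map_add_eq_mul, Circle.smul_def,
      Circle.coe_mul, smul_eq_mul]
    ring
  rw [key, norm_smul, norm_mul, norm_mul, Circle.norm_coe, one_mul, hc, Complex.norm_real,
    Real.norm_of_nonneg hDpos.le, Real.norm_of_nonneg (Real.rpow_nonneg hDpos.le _), ← mul_assoc]
  congr 1
  nth_rewrite 1 [← Real.rpow_one D]
  rw [← Real.rpow_add hDpos]
  norm_num

theorem fourierInv_conjS (f : 𝓢(E d, ℂ)) (a : E d) :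
    (𝓕⁻ (conjS f) : 𝓢(E d, ℂ)) a = (starRingEnd ℂ) ((𝓕 f : 𝓢(E d, ℂ)) a) := by
  simp only [SchwartzMap.fourier_coe, SchwartzMap.fourierInv_coe, Real.fourier_eq,
    Real.fourierInv_eq, ← integral_conj]
  refine integral_congr_ae (.of_forall fun v => ?_)
  simp [conjS_apply, Circle.smul_def, AddChar.map_neg_eq_inv]

/-- The wavelet transform of the inverse Fourier transform of a finite measure. -/
theorem waveletTransform_fourierInv_measure (ψ : 𝓢(E d, ℂ)) (ν : Measure (E d))
    [IsFiniteMeasure ν] (x : E d) (h : GL (Fin d) ℝ) :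
    waveletTransform ψ (𝓕⁻ ν.toTemperedDistribution) x h =
      ∫ a, (starRingEnd ℂ) ((𝓕 (quasiReg x h ψ) : 𝓢(E d, ℂ)) a) ∂ν := by
  rw [waveletTransform, TemperedDistribution.fourierInv_apply,
    Measure.toTemperedDistribution_apply ν]
  simp only [fourierInv_conjS]

/-! ### Regular directed points of Fourier transforms of measures -/

theorem exists_norm_le_one_add_norm_pow_inv (f : 𝓢(E d, ℂ)) (N : ℕ) :
    ∃ C : ℝ, 0 < C ∧ ∀ y, ‖f y‖ ≤ C * ((1 + ‖y‖) ^ N)⁻¹ := by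
  let S := (2 : ℝ) ^ N * ((Finset.Iic (N, 0)).sup fun m => SchwartzMap.seminorm ℝ m.1 m.2) f
  refine ⟨max S 1, by positivity, fun y => ?_⟩
  have h := SchwartzMap.one_add_le_sup_seminorm_apply (𝕜 := ℝ) (m := (N, 0)) le_rfl le_rfl f y
  rw [norm_iteratedFDeriv_zero] at h
  rw [← div_eq_mul_inv, le_div_iff₀' (by positivity)]
  exact h.trans (le_max_left _ _)

theorem continuous_integral_sub (Φ : 𝓢(E d, ℂ)) (ν : Measure (E d)) [IsFiniteMeasure ν] :
    Continuous fun η => ∫ a, Φ (η - a) ∂ν := by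
  obtain ⟨C, -, hC⟩ := exists_norm_le_one_add_norm_pow_inv Φ 0
  refine continuous_of_dominated (bound := fun _ => C) (fun η => ?_) (fun η => ?_)
    (integrable_const C) ?_
  · exact (Φ.continuous.comp (by fun_prop)).aestronglyMeasurable
  · exact .of_forall fun a => by simpa using hC (η - a)
  · exact .of_forall fun a => Φ.continuous.comp (by fun_prop)

/-- Modulating `φ` by the character of frequency `a` translates its Fourier transform by `a`; the
rest is the self-adjointness of the Fourier integral. -/
theorem fourierInv_smulLeft_fourier {φ : E d → ℂ} (hφ : HasCompactSupport φ)
    (hφs : ContDiff ℝ ∞ φ) (f : 𝓢(E d, ℂ)) (a : E d) :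
    (𝓕⁻ (SchwartzMap.smulLeftCLM ℂ φ (𝓕 f)) : 𝓢(E d, ℂ)) a =
      ∫ η, f η * (𝓕 (hφ.toSchwartzMap hφs) : 𝓢(E d, ℂ)) (η - a) := by
  have hint : Integrable fun y => 𝐞 (inner ℝ y a) • φ y := by
    refine (Continuous.integrable_of_hasCompactSupport ?_ ?_)
    · have := hφs.continuous
      fun_prop
    · exact hφ.mono fun y hy h0 => hy (by simp [h0])
  have hflip := VectorFourier.integral_fourierIntegral_smul_eq_flip (L := innerₗ (E d))
    (e := 𝐞) (μ := volume) (ν := volume) Real.continuous_fourierChar continuous_inner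
    f.integrable hint
  simp only [smul_eq_mul] at hflip
  have hΦ : ∀ η, (𝓕 (hφ.toSchwartzMap hφs) : 𝓢(E d, ℂ)) (η - a) =
      VectorFourier.fourierIntegral 𝐞 volume (innerₗ (E d)).flip
        (fun y => 𝐞 (inner ℝ y a) • φ y) η := by
    intro η
    simp only [SchwartzMap.fourier_coe, Real.fourier_eq, VectorFourier.fourierIntegral]
    refine integral_congr_ae (.of_forall fun y => ?_)
    simp only [LinearMap.flip_apply, innerₗ_apply_apply, smul_smul, ← AddChar.map_add_eq_mul,
      inner_sub_right, real_inner_comm]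
    congr 2
    ring
  simp only [hΦ, ← hflip]
  rw [SchwartzMap.fourierInv_coe, Real.fourierInv_eq]
  refine integral_congr_ae (.of_forall fun y => ?_)
  simp only [SchwartzMap.smulLeftCLM_apply (hφ.hasTemperateGrowth hφs), SchwartzMap.fourier_coe,
    Circle.smul_def, smul_eq_mul]
  change _ = 𝓕 (f : E d → ℂ) y * _
  ring

/-- Localizing by `φ` convolves `ν` with `φ̂`. Fubini applies because `ν` is finite, `φ̂` bounded
and `f` integrable. -/
theorem isGivenBy_fourier_smulLeft {φ : E d → ℂ} (hφ : HasCompactSupport φ)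
    (hφs : ContDiff ℝ ∞ φ) (ν : Measure (E d)) [IsFiniteMeasure ν] :
    IsGivenBy (𝓕 (TemperedDistribution.smulLeftCLM ℂ φ (𝓕⁻ ν.toTemperedDistribution)))
      fun η => ∫ a, (𝓕 (hφ.toSchwartzMap hφs) : 𝓢(E d, ℂ)) (η - a) ∂ν := by
  intro f
  set Φ : 𝓢(E d, ℂ) := 𝓕 (hφ.toSchwartzMap hφs)
  obtain ⟨C, -, hC⟩ := exists_norm_le_one_add_norm_pow_inv Φ 0
  have hprod : Integrable (Function.uncurry fun a η : E d => f η * Φ (η - a)) (ν.prod volume) := by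
    refine (f.integrable.comp_snd ν).mul_bdd (c := C) ?_ (.of_forall fun q => ?_)
    · exact (Φ.continuous.comp (by fun_prop)).aestronglyMeasurable
    · simpa using hC (q.2 - q.1)
  have hswap := integral_integral_swap hprod
  have hr := hprod.integral_prod_right
  simp only [Function.uncurry, integral_const_mul] at hswap hr
  refine ⟨hr, ?_⟩
  rw [← hswap, TemperedDistribution.fourier_apply, TemperedDistribution.smulLeftCLM_apply_apply,
    TemperedDistribution.fourierInv_apply, Measure.toTemperedDistribution_apply ν]
  simp only [fourierInv_smulLeft_fourier hφ hφs, Φ]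

/-- Projecting onto `z` bounds the distance from `η` to the hyperplane below by `κ ‖η‖`; `κ ≤ 1`
takes care of the summand `1`. -/
theorem mul_one_add_norm_le {z η a : E d} {κ : ℝ} (hκ : κ ≤ 1)
    (hη : κ * ‖η‖ * ‖z‖ ≤ inner ℝ z η) (hz : 0 < ‖z‖) (ha : inner ℝ z a = 0) :
    κ * (1 + ‖η‖) ≤ 1 + ‖η - a‖ := by
  have h1 : inner ℝ z (η - a) ≤ ‖z‖ * ‖η - a‖ := real_inner_le_norm _ _
  rw [inner_sub_right, ha, sub_zero] at h1
  have h2 : κ * ‖η‖ ≤ ‖η - a‖ := le_of_mul_le_mul_right (by linarith) hz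
  linarith

/-- If a finite measure is concentrated on a hyperplane, then its inverse Fourier transform is
regular in all directions outside of this hyperplane. -/
theorem isRegularDirectedPoint_fourierInv_measure (ν : Measure (E d)) [IsFiniteMeasure ν]
    (x : E d) (ξ : Sph d) (z : E d) (hz : 0 < inner ℝ z (ξ : E d))
    (hν : ∀ᵐ a ∂ν, inner ℝ z a = 0) :
    IsRegularDirectedPoint (𝓕⁻ ν.toTemperedDistribution) x ξ := by
  let b : ContDiffBump x := ⟨1, 2, one_pos, one_lt_two⟩
  let φ : E d → ℂ := fun y => (b y : ℂ)
  have hφs : ContDiff ℝ ∞ φ := Complex.ofRealCLM.contDiff.comp b.contDiff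
  have hφ : HasCompactSupport φ :=
    b.hasCompactSupport.mono fun y hy => by simpa [φ] using hy
  have hzn : 0 < ‖z‖ := norm_pos_iff.2 fun h => by simp [h] at hz
  set Φ : 𝓢(E d, ℂ) := 𝓕 (hφ.toSchwartzMap hφs) with hΦ
  -- The half matches the set of directions `w` with `⟨z, w⟩ > ⟨z, ξ⟩ / 2` used as `W` below.
  set κ : ℝ := min 1 (inner ℝ z (ξ : E d) / 2 / ‖z‖)
  have hκ : 0 < κ := by positivity
  refine ⟨φ, hφs, hφ, ?_, _, continuous_integral_sub Φ ν, isGivenBy_fourier_smulLeft hφ hφs ν,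
    {w | inner ℝ z (ξ : E d) / 2 < inner ℝ z (w : E d)}, ?_, ?_, fun N _ => ?_⟩
  · filter_upwards [b.eventuallyEq_one] with y hy
    simp [φ, hy]
  · exact isOpen_lt continuous_const (by fun_prop)
  · change inner ℝ z (ξ : E d) / 2 < inner ℝ z (ξ : E d)
    linarith
  · obtain ⟨C, hC0, hC⟩ := exists_norm_le_one_add_norm_pow_inv Φ N
    -- The `+ 1` keeps the constant positive even for `ν = 0`.
    refine ⟨C * (κ ^ N)⁻¹ * (ν.real Set.univ + 1), by positivity, ?_⟩
    rintro _ ⟨w, hw, r, hr, rfl⟩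
    have hnorm : ‖r • (w : E d)‖ = r := by
      rw [norm_smul, norm_eq_of_mem_sphere, mul_one, Real.norm_of_nonneg hr.le]
    have hη : κ * ‖r • (w : E d)‖ * ‖z‖ ≤ inner ℝ z (r • (w : E d)) := by
      rw [hnorm, inner_smul_right, mul_comm κ r, mul_assoc]
      refine mul_le_mul_of_nonneg_left ?_ hr.le
      rw [← le_div_iff₀ hzn]
      refine (min_le_right _ _).trans ?_
      gcongr
      exact le_of_lt hw
    generalize r • (w : E d) = η at hη
    refine (norm_integral_le_of_norm_le_const (C := C * (κ ^ N)⁻¹ * ((1 + ‖η‖) ^ N)⁻¹) ?_).trans ?_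
    · filter_upwards [hν] with a ha
      refine (hC _).trans ?_
      rw [mul_assoc, ← mul_inv, ← mul_pow]
      have := mul_one_add_norm_le (min_le_left _ _) hη hzn ha
      gcongr
    · have h0 : 0 ≤ ν.real Set.univ := measureReal_nonneg
      rw [mul_right_comm]
      gcongr
      linarith

/-! ### The lacunary measure and its scales -/

/-- The finite measure `∑ 2⁻ᵐ δ_{a m}`. -/
def geometricDiracSum (a : ℕ → E d) : Measure (E d) :=
  Measure.sum fun m => (2⁻¹ : ENNReal) ^ m • Measure.dirac (a m)

instance isFiniteMeasure_geometricDiracSum (a : ℕ → E d) :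
    IsFiniteMeasure (geometricDiracSum a) := ⟨by
  simp [geometricDiracSum, Measure.sum_apply _ MeasurableSet.univ, ENNReal.tsum_geometric]⟩

theorem integral_geometricDiracSum {a : ℕ → E d} {F : E d → ℂ}
    (hF : Integrable F (geometricDiracSum a)) (n : ℕ) (h0 : ∀ m, m ≠ n → F (a m) = 0) :
    ∫ y, F y ∂geometricDiracSum a = (2⁻¹ : ℝ) ^ n • F (a n) := by
  rw [geometricDiracSum, integral_sum_measure hF, tsum_eq_single n]
  · simp [integral_smul_measure]
  · intro m hm
    simp [integral_smul_measure, h0 m hm]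

theorem ae_geometricDiracSum {a : ℕ → E d} {z : E d} (h : ∀ m, inner ℝ z (a m) = 0) :
    ∀ᵐ y ∂geometricDiracSum a, inner ℝ z y = 0 := by
  have hm : MeasurableSet {y : E d | inner ℝ z y = 0} :=
    (isClosed_eq (by fun_prop) continuous_const).measurableSet
  rw [geometricDiracSum, Measure.ae_sum_iff]
  exact fun m => Measure.ae_smul_measure ((ae_dirac_iff hm).2 (h m)) _

/-- The product is `r ^ (n - m)`, hence at most `r` or at least `r⁻¹`, and `r⁻¹ - 1 ≥ 1 - r`. Thus a
ball of relative radius `1 - r` around one frequency contains no other. -/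
theorem one_sub_le_abs_pow_mul_inv_pow_sub_one {r : ℝ} (hr : 0 < r) (hr1 : r < 1) {m n : ℕ}
    (hmn : m ≠ n) : 1 - r ≤ |r ^ n * r⁻¹ ^ m - 1| := by
  rcases lt_or_gt_of_ne hmn with h | h
  · obtain ⟨k, rfl⟩ := Nat.exists_eq_add_of_lt h
    have h1 : r ^ (m + k + 1) * r⁻¹ ^ m = r ^ k * r := by
      rw [pow_succ, pow_add, inv_pow]
      field_simp
    have h2 : r ^ k * r ≤ 1 * r := by
      gcongr
      exact pow_le_one₀ hr.le hr1.le
    rw [h1, abs_sub_comm]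
    exact le_trans (by linarith) (le_abs_self _)
  · obtain ⟨k, rfl⟩ := Nat.exists_eq_add_of_lt h
    have h1 : r ^ n * r⁻¹ ^ (n + k + 1) = r⁻¹ ^ k * r⁻¹ := by
      rw [pow_succ, pow_add, inv_pow, inv_pow]
      field_simp
    have h2 : 1 * r⁻¹ ≤ r⁻¹ ^ k * r⁻¹ := by
      gcongr
      exact one_le_pow₀ ((one_lt_inv₀ hr).2 hr1).le
    have h3 : 2 ≤ r + r⁻¹ := by
      rw [← sub_nonneg]
      have : r + r⁻¹ - 2 = (1 - r) ^ 2 / r := by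
        field_simp
        ring
      rw [this]
      positivity
    rw [h1]
    exact le_trans (by linarith) (le_abs_self _)

/-- A geometric sequence that is dominated by arbitrarily fast geometric sequences is trivial. -/
theorem false_of_geometric_le {A q r : ℝ} (hA : 0 < A) (hq : 0 < q) (hr : 0 < r) (hr1 : r < 1)
    (h : ∀ N : ℕ, 1 ≤ N → ∃ C : ℝ, ∀ᶠ n : ℕ in Filter.atTop, A * q ^ n ≤ C * (r ^ N) ^ n) :
    False := by
  obtain ⟨k, hk⟩ := exists_pow_lt_of_lt_one hq hr1
  -- The exponent `k + 1` meets the requirement `1 ≤ N`.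
  have hk' : r ^ (k + 1) < q := by
    rw [pow_succ]
    exact lt_of_le_of_lt (mul_le_of_le_one_right (by positivity) hr1.le) hk
  obtain ⟨C, hC⟩ := h (k + 1) (by simp)
  have hlim : Filter.Tendsto (fun n : ℕ => C * (r ^ (k + 1) / q) ^ n) Filter.atTop (𝓝 (C * 0)) :=
    (tendsto_pow_atTop_nhds_zero_of_lt_one (by positivity) ((div_lt_one hq).2 hk')).const_mul C
  have hle : A ≤ C * 0 := by
    refine ge_of_tendsto hlim (hC.mono fun n hn => ?_)
    rw [div_pow, mul_div_assoc', le_div_iff₀ (by positivity)]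
    exact hn
  linarith

theorem dualAct_zero (h : GL (Fin d) ℝ) : dualAct h 0 = 0 := by
  simp [dualAct_eq_toLp]

section Scalar

variable {g : GL (Fin d) ℝ} {r : ℝ}

theorem dualAct_scalar_pow_mul
    (hg : (g : Matrix (Fin d) (Fin d) ℝ) = r • (1 : Matrix (Fin d) (Fin d) ℝ)) (n : ℕ)
    (h : GL (Fin d) ℝ) (η : E d) : dualAct (g ^ n * h) η = r ^ n • dualAct h η := by
  have h1 : dualAct (g ^ n) η = r ^ n • η := by
    simp [dualAct_eq_toLp, hg, smul_pow, Matrix.transpose_smul, Matrix.smul_mulVec]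
  rw [dualAct_mul, h1, dualAct_smul]

theorem opNorm_scalar_pow_mul
    (hg : (g : Matrix (Fin d) (Fin d) ℝ) = r • (1 : Matrix (Fin d) (Fin d) ℝ)) (hr : 0 < r) (n : ℕ)
    (h : GL (Fin d) ℝ) : opNorm (g ^ n * h) = r ^ n * opNorm h := by
  have h1 : (matAct (g ^ n * h) : E d →L[ℝ] E d) = r ^ n • (matAct h : E d →L[ℝ] E d) := by
    ext y : 1
    change matAct (g ^ n * h) y = r ^ n • matAct h y
    simp [matAct_apply, hg, smul_pow, Matrix.smul_mulVec]
  rw [opNorm, h1, norm_smul, Real.norm_of_nonneg (by positivity), opNorm]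

/-- The witness is `r⁻ⁿ ξ`, the image of `hᵀ ξ ∈ V`; its direction `ξ` survives any shrinking of
`W`. -/
theorem mem_outerSet_scalar_pow_mul {H : Subgroup (GL (Fin d) ℝ)} {W : Set (Sph d)}
    {V : Set (E d)} {R : ℝ}
    (hg : (g : Matrix (Fin d) (Fin d) ℝ) = r • (1 : Matrix (Fin d) (Fin d) ℝ)) (hr : 0 < r)
    (hgH : g ∈ H) {h : GL (Fin d) ℝ} (hh : h ∈ H) {ξ : Sph d} (hξ : ξ ∈ W)
    (hV : dualAct h (ξ : E d) ∈ V) {n : ℕ} (hn : R < r⁻¹ ^ n) : g ^ n * h ∈ outerSet H W V R := by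
  refine ⟨H.mul_mem (H.pow_mem hgH n) hh, r⁻¹ ^ n • (ξ : E d), ⟨_, hV, ?_⟩, ⟨ξ, hξ, _, ?_, rfl⟩, ?_⟩
  · have : dualAct h (ξ : E d) = dualAct (g ^ n * h) (r⁻¹ ^ n • (ξ : E d)) := by
      rw [dualAct_scalar_pow_mul hg, dualAct_smul, smul_smul, ← mul_pow, mul_inv_cancel₀ hr.ne',
        one_pow, one_smul]
    rw [this, dualAct_inv_dualAct]
  · positivity
  · rw [mem_closedBall_zero_iff, norm_smul, norm_eq_of_mem_sphere, mul_one,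
      Real.norm_of_nonneg (by positivity)]
    exact not_le.2 hn

/-- The wavelet transform of a lacunary Fourier series detects a single frequency at each
scale. -/
theorem norm_waveletTransform_geometricDiracSum
    (hg : (g : Matrix (Fin d) (Fin d) ℝ) = r • (1 : Matrix (Fin d) (Fin d) ℝ)) (hr : 0 < r)
    (hr1 : r < 1) (h : GL (Fin d) ℝ) (η : E d) (ψ : 𝓢(E d, ℂ))
    (hψ : tsupport (𝓕 ψ : 𝓢(E d, ℂ)) ⊆
      Metric.ball (dualAct h η) ((1 - r) * ‖dualAct h η‖)) (x : E d) (n : ℕ) :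
    ‖waveletTransform ψ
        (𝓕⁻ (geometricDiracSum fun m => r⁻¹ ^ m • η).toTemperedDistribution) x (g ^ n * h)‖ =
      |(h : Matrix (Fin d) (Fin d) ℝ).det| ^ (1 / 2 : ℝ) * ‖(𝓕 ψ : 𝓢(E d, ℂ)) (dualAct h η)‖ *
        (2⁻¹ * |(g : Matrix (Fin d) (Fin d) ℝ).det| ^ (1 / 2 : ℝ)) ^ n := by
  set Ψ : 𝓢(E d, ℂ) := 𝓕 (quasiReg x (g ^ n * h) ψ) with hΨ
  have hnorm : ∀ m, ‖Ψ (r⁻¹ ^ m • η)‖ =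
      |((g ^ n * h : GL (Fin d) ℝ) : Matrix (Fin d) (Fin d) ℝ).det| ^ (1 / 2 : ℝ) *
        ‖(𝓕 ψ : 𝓢(E d, ℂ)) ((r ^ n * r⁻¹ ^ m) • dualAct h η)‖ := fun m => by
    rw [hΨ, norm_fourier_quasiReg, dualAct_scalar_pow_mul hg, dualAct_smul, smul_smul]
  rw [waveletTransform_fourierInv_measure, integral_geometricDiracSum ?_ n ?_, norm_smul,
    RCLike.norm_conj, hnorm, ← mul_pow, mul_inv_cancel₀ hr.ne', one_pow, one_smul,
    Real.norm_of_nonneg (by positivity), Units.val_mul, Matrix.det_mul, abs_mul,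
    Real.mul_rpow (abs_nonneg _) (abs_nonneg _), Units.val_pow_eq_pow_val, Matrix.det_pow, abs_pow,
    ← Real.rpow_natCast_mul (abs_nonneg _), mul_comm (n : ℝ), Real.rpow_mul_natCast (abs_nonneg _),
    mul_pow]
  · ring
  · obtain ⟨C, -, hC⟩ := exists_norm_le_one_add_norm_pow_inv Ψ 0
    refine Integrable.of_bound (C := C) ?_ (.of_forall fun y => ?_)
    · exact (Complex.continuous_conj.comp Ψ.continuous).aestronglyMeasurable
    · rw [RCLike.norm_conj]
      simpa using hC y
  · intro m hm
    rw [map_eq_zero, ← norm_eq_zero, hnorm, mul_eq_zero, norm_eq_zero]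
    -- For `m ≠ n` the rescaled frequency falls outside the ball that carries `ψ̂`.
    refine Or.inr (image_eq_zero_of_notMem_tsupport fun hmem => ?_)
    have hlt := hψ hmem
    rw [mem_ball_iff_norm] at hlt
    have : (r ^ n * r⁻¹ ^ m) • dualAct h η - dualAct h η =
        (r ^ n * r⁻¹ ^ m - 1) • dualAct h η := by
      rw [sub_smul, one_smul]
    rw [this, norm_smul, Real.norm_eq_abs] at hlt
    exact absurd hlt (not_lt.2 (mul_le_mul_of_nonneg_right
      (one_sub_le_abs_pow_mul_inv_pow_sub_one hr hr1 hm) (norm_nonneg _)))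

end Scalar

/-! ### Perturbing the direction and the contradiction -/

/-- In dimension at least two every unit vector can be perturbed to a vector that lies on a
hyperplane not containing the unit vector. -/
theorem exists_mem_inner_eq_zero (hd : 2 ≤ d) (ξ : Sph d) {O : Set (E d)} (hO : IsOpen O)
    (hξ : (ξ : E d) ∈ O) :
    ∃ η ∈ O, ∃ z : E d, inner ℝ z η = 0 ∧ 0 < inner ℝ z (ξ : E d) := by
  have hξn : ‖(ξ : E d)‖ = 1 := norm_eq_of_mem_sphere ξ
  obtain ⟨w, hw, hw0⟩ : ∃ w ∈ (ℝ ∙ (ξ : E d))ᗮ, w ≠ 0 := by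
    refine Submodule.exists_mem_ne_zero_of_ne_bot fun hbot => ?_
    have h1 := (ℝ ∙ (ξ : E d)).finrank_add_finrank_orthogonal
    have h2 := finrank_span_le_card (R := ℝ) ({(ξ : E d)} : Set (E d))
    rw [hbot, finrank_bot, finrank_euclideanSpace_fin] at h1
    simp at h2
    omega
  have hξw : inner ℝ (ξ : E d) w = 0 := Submodule.mem_orthogonal_singleton_iff_inner_right.1 hw
  have hwξ : inner ℝ w (ξ : E d) = 0 := by rw [real_inner_comm, hξw]
  have hcont : Continuous fun t : ℝ => (ξ : E d) + t • w := by fun_prop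
  have hmem : ∀ᶠ t in 𝓝 (0 : ℝ), (ξ : E d) + t • w ∈ O :=
    hcont.continuousAt.eventually_mem (hO.mem_nhds (by simpa using hξ))
  obtain ⟨t, ht0, ht⟩ :=
    ((hmem.filter_mono nhdsWithin_le_nhds).and (self_mem_nhdsWithin (s := Set.Ioi (0 : ℝ)))).exists
  have htpos : 0 < t := ht
  have hww : 0 < inner ℝ w w := real_inner_self_pos.2 hw0
  -- For `η = ξ + t w` with `w ⊥ ξ`, this `z` is orthogonal to `η`, and `⟨z, ξ⟩ = t ‖w‖²` is
  -- positive since `t > 0`.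
  refine ⟨_, ht0, (t * inner ℝ w w) • (ξ : E d) - w, ?_, ?_⟩
  · simp only [inner_sub_left, inner_add_right, inner_smul_left, inner_smul_right, hξw, hwξ,
      real_inner_self_eq_norm_sq, hξn]
    simp
  · simp only [inner_sub_left, inner_smul_left, hwξ, real_inner_self_eq_norm_sq (ξ : E d), hξn]
    simp only [one_pow, mul_one, sub_zero, conj_trivial]
    positivity

/-- If the wavelet transform characterizes regular directed points, then the group contains no
contracting homothety. -/
theorem one_le_of_scalar_mem (hd : 2 ≤ d)
    (H : Subgroup (GL (Fin d) ℝ)) (hH : IsClosed (H : Set (GL (Fin d) ℝ)))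
    [MeasurableSpace H] [BorelSpace H] (μ : Measure H) [μ.IsHaarMeasure] (ξ₀ : E d)
    (hopen : IsOpen (dualOrbit H ξ₀)) (hstab : IsCompact (dualStabilizer H ξ₀))
    (x : E d) (ξ : Sph d) (hξ : (ξ : E d) ∈ dualOrbit H ξ₀)
    (V : Set (E d)) (hV : V.Nonempty) (hVo : IsOpen V) (hVO : V ⊆ dualOrbit H ξ₀)
    (hdecay : ∀ u : 𝓢'(E d, ℂ), IsRegularDirectedPoint u x ξ →
      ∀ ψ : 𝓢(E d, ℂ), IsAdmissible H μ (dualOrbit H ξ₀) ψ →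
        tsupport (𝓕 ψ : 𝓢(E d, ℂ)) ⊆ V →
        ∃ W : Set (Sph d), IsOpen W ∧ ξ ∈ W ∧ ∃ R : ℝ, 0 < R ∧
          ∀ N : ℕ, 1 ≤ N → ∃ C : ℝ, 0 < C ∧ ∀ h ∈ outerSet H W V R,
            ‖waveletTransform ψ u x h‖ ≤ C * opNorm h ^ N)
    {g : GL (Fin d) ℝ} (hgH : g ∈ H) {r : ℝ} (hr : 0 < r)
    (hg : (g : Matrix (Fin d) (Fin d) ℝ) = r • (1 : Matrix (Fin d) (Fin d) ℝ)) : 1 ≤ r := by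
  by_contra! hr1
  obtain ⟨h, hh, hhV⟩ : ∃ h ∈ H, dualAct h (ξ : E d) ∈ V := by
    obtain ⟨v, hv⟩ := hV
    obtain ⟨k, hk, hkv⟩ := hVO hv
    obtain ⟨l, hl, hlξ⟩ := hξ
    refine ⟨l⁻¹ * k, H.mul_mem (H.inv_mem hl) hk, ?_⟩
    rwa [← hlξ, dualAct_mul, dualAct_inv_dualAct, hkv]
  -- Both `hᵀ ξ` and `hᵀ η` lie in `V`: the former puts `gⁿ h` into the outer set, the latter lets
  -- `ψ` detect `u`.
  obtain ⟨η, hη, z, hzη, hzξ⟩ := exists_mem_inner_eq_zero hd ξ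
    (hVo.preimage (continuous_dualAct continuous_const continuous_id : Continuous (dualAct h))) hhV
  -- The orbit of `0` is `{0}`, whereas this orbit contains a unit vector.
  have hη0 : dualAct h η ≠ 0 := fun h0 => by
    obtain ⟨k, -, hk⟩ := hVO hη
    obtain ⟨l, -, hl⟩ := hξ
    have hξ0 : ξ₀ = 0 := by
      rw [← dualAct_inv_dualAct k ξ₀, hk.trans h0, dualAct_zero]
    have hn : ‖(ξ : E d)‖ = 1 := norm_eq_of_mem_sphere ξ
    rw [← hl, hξ0, dualAct_zero, norm_zero] at hn
    exact zero_ne_one hn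
  obtain ⟨ψ, hψ, hψsupp, hψp⟩ := exists_isAdmissible H hH μ ξ₀ hopen hstab (hVO hη)
    (Filter.inter_mem (hVo.mem_nhds hη) (Metric.ball_mem_nhds (dualAct h η)
      (mul_pos (sub_pos.2 hr1) (norm_pos_iff.2 hη0))))
  have hreg := isRegularDirectedPoint_fourierInv_measure
    (geometricDiracSum fun m => r⁻¹ ^ m • η) x ξ z hzξ
    (ae_geometricDiracSum fun m => by rw [inner_smul_right, hzη, mul_zero])
  obtain ⟨W, -, hξW, R, -, hdec⟩ := hdecay _ hreg ψ hψ (hψsupp.trans Set.inter_subset_left)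
  refine false_of_geometric_le
    (mul_pos (Real.rpow_pos_of_pos (abs_det_pos h) (1 / 2)) (norm_pos_iff.2 hψp))
    (mul_pos (inv_pos.2 two_pos) (Real.rpow_pos_of_pos (abs_det_pos g) (1 / 2))) hr hr1
    fun N hN => ?_
  obtain ⟨C, -, hC⟩ := hdec N hN
  refine ⟨C * opNorm h ^ N, ?_⟩
  filter_upwards [(tendsto_pow_atTop_atTop_of_one_lt ((one_lt_inv₀ hr).2 hr1)).eventually_gt_atTop R]
    with n hn
  have hb := hC _ (mem_outerSet_scalar_pow_mul hg hr hgH hh hξW hhV hn)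
  rw [norm_waveletTransform_geometricDiracSum hg hr hr1 h η ψ
    (hψsupp.trans Set.inter_subset_right), opNorm_scalar_pow_mul hg hr] at hb
  calc _ ≤ _ := hb
    _ = _ := by ring

end WaveletWF

end

theorem mainTheorem8 {d : ℕ} (hd : 2 ≤ d)
    (H : Subgroup (GL (Fin d) ℝ)) (hH : IsClosed (H : Set (GL (Fin d) ℝ)))
    [MeasurableSpace H] [BorelSpace H] (μ : Measure H) [μ.IsHaarMeasure]
    (ξ₀ : WaveletWF.E d)
    (hopen : IsOpen (WaveletWF.dualOrbit H ξ₀))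
    (hstab : ∀ η ∈ WaveletWF.dualOrbit H ξ₀, IsCompact (WaveletWF.dualStabilizer H η))
    (x : WaveletWF.E d) (ξ : WaveletWF.Sph d)
    (hξ : (ξ : WaveletWF.E d) ∈ WaveletWF.dualOrbit H ξ₀)
    (V : Set (WaveletWF.E d)) (hV : V.Nonempty)
    (hVO : WaveletWF.CompactlyInside V (WaveletWF.dualOrbit H ξ₀))
    (hdecay : ∀ u : 𝓢'(WaveletWF.E d, ℂ), WaveletWF.IsRegularDirectedPoint u x ξ →
      ∀ ψ : 𝓢(WaveletWF.E d, ℂ),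
        WaveletWF.IsAdmissible H μ (WaveletWF.dualOrbit H ξ₀) ψ →
        tsupport (𝓕 ψ : 𝓢(WaveletWF.E d, ℂ)) ⊆ V →
        ∃ W : Set (WaveletWF.Sph d), IsOpen W ∧ ξ ∈ W ∧ ∃ R : ℝ, 0 < R ∧
          ∀ N : ℕ, 1 ≤ N → ∃ C : ℝ, 0 < C ∧ ∀ h ∈ WaveletWF.outerSet H W V R,
            ‖WaveletWF.waveletTransform ψ u x h‖ ≤ C * WaveletWF.opNorm h ^ N) :
    (H : Set (GL (Fin d) ℝ)) ∩
        {h | ∃ r : ℝ, 0 < r ∧ (h : Matrix (Fin d) (Fin d) ℝ) = r • (1 : Matrix (Fin d) (Fin d) ℝ)}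
      = {1} := by
  obtain ⟨-, -, -, hVO'⟩ := id hVO
  have key := fun (g : GL (Fin d) ℝ) (hg : g ∈ H) (r : ℝ) (hr : 0 < r) =>
    WaveletWF.one_le_of_scalar_mem hd H hH μ ξ₀ hopen
      (hstab ξ₀ ⟨1, H.one_mem, WaveletWF.dualAct_one ξ₀⟩) x ξ hξ V hV hVO.1
      (subset_closure.trans hVO') hdecay hg hr
  ext g
  constructor
  · rintro ⟨hgH, r, hr, hg⟩
    have h1 : 1 ≤ r := key g hgH r hr hg
    have hinv : ((g⁻¹ : GL (Fin d) ℝ) : Matrix (Fin d) (Fin d) ℝ) =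
        r⁻¹ • (1 : Matrix (Fin d) (Fin d) ℝ) := by
      rw [Matrix.coe_units_inv, hg]
      refine Matrix.inv_eq_right_inv ?_
      rw [smul_mul_smul_comm, mul_inv_cancel₀ hr.ne', one_smul, one_mul]
    -- The bound for `g⁻¹` excludes `r > 1`.
    have h2 : 1 ≤ r⁻¹ := key g⁻¹ (H.inv_mem hgH) r⁻¹ (inv_pos.2 hr) hinv
    have hr1 : r = 1 := le_antisymm ((one_le_inv₀ hr).1 h2) h1
    rw [Set.mem_singleton_iff]
    exact Units.ext (by rw [hg, hr1, one_smul, Units.val_one])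
  · rintro rfl
    exact ⟨H.one_mem, 1, one_pos, by simp⟩
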